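/- **Setting.** Let $\mathcal G$ be a DAG on a finite set $\mathcal X$ of nodes, each node $v$ being a random variable with values in a standard Borel space (discrete, continuous or mixed), and let $P$ be the joint distribution of these variables. Assume that $P$ factorizes along $\mathcal G$, $P=\prod_{v\in\mathcal X}P(v\mid Pa_v)$ (integration against $P$ is iterated integration, parents first, against regular conditional distributions of the nodes given their parents). A *trail* is a sequence $z_0\rightleftharpoons z_1\rightleftharpoons\dots\rightleftharpoons z_n$ of distinct nodes, where each $\rightleftharpoons$ is an edge $\to$ or $\gets$ of $\mathcal G$. Its node $z_k$ with $0<k<n$ is a *collider* of the trail if $z_{k-1}\to z_k\gets z_{k+1}$. The trail is *active* given $Z\subset\mathcal X$ if all its colliders belong to $Z$ and no other node of it does. Assume that $P$ is *faithful* to $\mathcal G$: whenever $A\perp\!\!\!\perp B\mid C$ under $P$, for pairwise disjoint $A,B,C\subset\mathcal X$, no trail from a node of $A$ to a node of $B$ is active given $C$. Write $I(u;v)\in[0,\infty]$ for the mutual information of $u$ and $v$, i.e. the Kullback–Leibler divergence of their joint law from the product of their laws. **Theorem.** Let $x\rightleftharpoons x_1\rightleftharpoons\dots\rightleftharpoons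 x_n$ be a trail in $\mathcal G$ with $I(x;x_1)<\infty$. Assume that $\mathcal G$ consists of this trail only (no other nodes or edges), or, more generally, that for every $k\le n$ its initial segment is the only trail from $x$ to $x_k$ in $\mathcal G$. 1. If the trail has no collider, then $$I(x;x_1)>I(x;x_2)>\dots>I(x;x_n).$$ 2. If the trail has a collider and $x_m$ is the first one, then $$I(x;x_1)>I(x;x_2)>\dots>I(x;x_m)>I(x;x_{m+1})=\dots=I(x;x_n)=0.$$ -/

import Mathlib

open MeasureTheory ProbabilityTheory
open scoped ENNReal

section BayesianNetwork

variable {V : Type*}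

/-- A directed graph is a DAG if it has no cycle `x₀ → x₁ → … → xₙ = x₀` with `n ≥ 1`. -/
def Digraph.IsDAG (G : Digraph V) : Prop :=
  ∀ v, ¬ Relation.TransGen G.Adj v v

/-- The skeleton: the undirected graph in which `u ≠ v` are adjacent iff `u → v` or `v → u`. -/
abbrev Digraph.skeleton (G : Digraph V) : SimpleGraph V :=
  G.toSimpleGraphInclusive

/- A trail `x₀ ⇌ x₁ ⇌ … ⇌ xₙ` of distinct nodes of `G` is a walk `p` in the skeleton of `G`
with `p.IsPath`; its nodes are `xₖ = p.getVert k` for `k ≤ p.length`. -/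

/-- The `k`-th node of the trail is a collider of the trail: it is an interior node, and
`xₖ₋₁ → xₖ ← xₖ₊₁`. -/
def IsCollider (G : Digraph V) {u v : V} (p : G.skeleton.Walk u v) (k : ℕ) : Prop :=
  0 < k ∧ k < p.length ∧
    G.Adj (p.getVert (k - 1)) (p.getVert k) ∧ G.Adj (p.getVert (k + 1)) (p.getVert k)

/-- A trail is active given `Z` if all its colliders and no other of its nodes belong to `Z`. -/
def IsActive (G : Digraph V) {u v : V} (p : G.skeleton.Walk u v) (Z : Finset V) : Prop :=
  (∀ k ≤ p.length, IsCollider G p k → p.getVert k ∈ Z) ∧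
    (∀ k ≤ p.length, ¬ IsCollider G p k → p.getVert k ∉ Z)

/-- `A` and `B` are d-separated given `C`: no trail from a node of `A` to a node of `B` is active
given `C`. -/
def DSeparated (G : Digraph V) (A B C : Finset V) : Prop :=
  ∀ u ∈ A, ∀ v ∈ B, ∀ p : G.skeleton.Walk u v, p.IsPath → ¬ IsActive G p C

/-- The graph consists of the trail `p` only: no other nodes and no other edges. -/
def IsTrailGraph (G : Digraph V) {u v : V} (p : G.skeleton.Walk u v) : Prop :=
  (∀ w, w ∈ p.support) ∧ ∀ e ∈ G.skeleton.edgeSet, e ∈ p.edges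

/-- For each node `xₖ` of the trail `p`, the initial segment of `p` is the only trail from the
first node of `p` to `xₖ`. -/
def IsUniqueTrail (G : Digraph V) {u v : V} (p : G.skeleton.Walk u v) : Prop :=
  ∀ k ≤ p.length, ∀ q : G.skeleton.Walk u (p.getVert k), q.IsPath → q = p.take k

variable {E : V → Type*} [∀ v, MeasurableSpace (E v)]

/-- The values `x_{Pa v}` of the parents of `v`. -/
def parentValues (G : Digraph V) (E : V → Type*) (v : V) (x : ∀ w, E w)
    (u : {u // G.Adj u v}) : E u :=
  x u

/-- An enumeration of all the nodes in which every node comes after its parents. -/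
def IsTopologicalOrder (G : Digraph V) (l : List V) : Prop :=
  l.Nodup ∧ (∀ v, v ∈ l) ∧ l.Pairwise fun a b => ¬ G.Adj b a

/-- For `l = [v₁, …, vₘ]`, the iterated integral
`∫ κ_{v₁}(dy₁ | x_{Pa v₁}) ⋯ ∫ κ_{vₘ}(dyₘ | x_{Pa vₘ}) f x`,
where the coordinates `v₁, …, vₘ` of `x` are successively replaced by `y₁, …, yₘ`. -/
noncomputable def iteratedIntegral [DecidableEq V] (G : Digraph V)
    (κ : ∀ v, Kernel (∀ u : {u // G.Adj u v}, E u) (E v)) :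
    List V → ((∀ v, E v) → ℝ≥0∞) → (∀ v, E v) → ℝ≥0∞
  | [], f, x => f x
  | v :: l, f, x =>
      ∫⁻ y, iteratedIntegral G κ l f (Function.update x v y) ∂(κ v (parentValues G E v x))

/-- The factorization `P(dx) = ∏ v, P(dxᵥ | x_{Pa v})`: the integral against `P` is obtained by
integrating out the nodes, parents first, against regular conditional distributions `κ v` of `xᵥ`
given `x_{Pa v}`. -/
def Factorizes [DecidableEq V] (G : Digraph V) (P : Measure (∀ v, E v)) : Prop :=
  ∃ κ : ∀ v, Kernel (∀ u : {u // G.Adj u v}, E u) (E v),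
    (∀ v, IsMarkovKernel (κ v)) ∧
    (∀ v, HasCondDistrib (fun x : ∀ w, E w => x v) (parentValues G E v) (κ v) P) ∧
    ∀ l, IsTopologicalOrder G l → ∀ f : (∀ v, E v) → ℝ≥0∞, Measurable f →
      ∀ x₀, ∫⁻ x, f x ∂P = iteratedIntegral G κ l f x₀

/-- Under `P`, the variables of `A` and those of `B` are independent given those of `C`. -/
def CondIndepNodes [Countable V] [∀ v, StandardBorelSpace (E v)] (P : Measure (∀ v, E v))
    [IsFiniteMeasure P] (A B C : Finset V) : Prop :=
  CondIndepFun (MeasurableSpace.comap (C.restrict (π := E)) inferInstance)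
    (C.measurable_restrict (X := E)).comap_le (A.restrict (π := E)) (B.restrict (π := E)) P

/-- `P` is faithful to `G`: every conditional independence of `P` is displayed by `G`. -/
def Faithful [Countable V] [∀ v, StandardBorelSpace (E v)] (G : Digraph V)
    (P : Measure (∀ v, E v)) [IsFiniteMeasure P] : Prop :=
  ∀ A B C : Finset V, Disjoint A B → Disjoint A C → Disjoint B C →
    CondIndepNodes P A B C → DSeparated G A B C

/-- The mutual information `I(u ; v)` of two nodes: the Kullback–Leibler divergence of the joint
law of the two variables from the product of their laws. -/
noncomputable def mutualInfo (P : Measure (∀ v, E v)) (u v : V) : ℝ≥0∞ :=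
  InformationTheory.klDiv (P.map fun x => (x u, x v))
    ((P.map fun x => x u).prod (P.map fun x => x v))

end BayesianNetwork

/-! Two facts combine: a strict data processing inequality, and the way the edges of the trail cut
the graph.

For a Markov chain X - Y - Z, the chain rule for the Kullback–Leibler divergence gives I(X;Z) + D ≤
I(X;Y), where D measures how far the law of Y given (Z, X) is from that of Y given Z. If I(X;Y) is
finite, equality of the two informations forces D = 0, that is, X and Y independent given Z
(`klDiv_map_prod_lt_of_condIndepFun`).

Uniqueness of the trail makes each of its edges a bridge of the skeleton (`IsUniqueTrail.isBridge`).
At a non-collider `xₖ`, cutting one bridge leaving `xₖ` shows that x - `xₖ` - `xₖ₊₁` is a Markov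
chain; at a collider, cutting both its edges leaves two disjoint ancestral sets, which are
independent. Up to the first collider, faithfulness supplies strictness: the segment from x to `xₖ`
is active given `xₖ₊₁`, so x and `xₖ` are dependent given `xₖ₊₁`. It is also active given ∅, so the
information is still positive at the first collider and vanishes just after it. -/

/-! ### Strict data processing and criteria for conditional independence -/

section DataProcessing

variable {Ω α β γ : Type*} {mΩ : MeasurableSpace Ω} {mα : MeasurableSpace α}
  {mβ : MeasurableSpace β} {mγ : MeasurableSpace γ} {μ : Measure Ω} [IsProbabilityMeasure μ]
  {X : Ω → α} {Y : Ω → β} {Z : Ω → γ}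

/-- The law of `((Y, X'), Z)` where `X'` has law `ρ` and is independent of `(Y, Z)`. -/
lemma compProd_prod_condDistrib [StandardBorelSpace γ] [Nonempty γ] (hY : Measurable Y)
    (hZ : Measurable Z) (ρ : Measure α) [IsProbabilityMeasure ρ] :
    ((μ.map Y).prod ρ) ⊗ₘ (condDistrib Z Y μ).prodMkRight α =
      ((μ.map fun ω => (Y ω, Z ω)).prod ρ).map fun p => ((p.1.1, p.2), p.1.2) := by
  have := Measure.isProbabilityMeasure_map (μ := μ) hY.aemeasurable
  have := Measure.isProbabilityMeasure_map (μ := μ) (hY.prodMk hZ).aemeasurable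
  refine Measure.ext_of_lintegral _ fun f hf => ?_
  rw [Measure.lintegral_compProd hf, lintegral_map hf (by fun_prop),
    lintegral_prod _ (Measurable.lintegral_kernel_prod_right' hf).aemeasurable,
    lintegral_prod _ (by fun_prop), ← compProd_map_condDistrib hZ.aemeasurable,
    Measure.lintegral_compProd]
  · refine lintegral_congr fun y => ?_
    simp only [Kernel.prodMkRight_apply]
    rw [lintegral_lintegral_swap]
    fun_prop
  · exact Measurable.lintegral_prod_right' (f := fun p : (β × γ) × α => f ((p.1.1, p.2), p.1.2))
      (by fun_prop)

/-- Strict form of the data processing inequality for a Markov chain `X - Y - Z`. -/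
theorem klDiv_map_prod_lt_of_condIndepFun [StandardBorelSpace Ω] [StandardBorelSpace α]
    [Nonempty α] [StandardBorelSpace β] [Nonempty β] [StandardBorelSpace γ] [Nonempty γ]
    (hX : Measurable X) (hY : Measurable Y) (hZ : Measurable Z)
    (h : X ⟂ᵢ[Y, hY; μ] Z) (hne : ¬ X ⟂ᵢ[Z, hZ; μ] Y)
    (hfin : InformationTheory.klDiv (μ.map fun ω => (X ω, Y ω))
      ((μ.map X).prod (μ.map Y)) ≠ ∞) :
    InformationTheory.klDiv (μ.map fun ω => (X ω, Z ω)) ((μ.map X).prod (μ.map Z)) <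
      InformationTheory.klDiv (μ.map fun ω => (X ω, Y ω)) ((μ.map X).prod (μ.map Y)) := by
  have pX := Measure.isProbabilityMeasure_map (μ := μ) hX.aemeasurable
  have pY := Measure.isProbabilityMeasure_map (μ := μ) hY.aemeasurable
  have pZ := Measure.isProbabilityMeasure_map (μ := μ) hZ.aemeasurable
  have pYX := Measure.isProbabilityMeasure_map (μ := μ) (hY.prodMk hX).aemeasurable
  have pZX := Measure.isProbabilityMeasure_map (μ := μ) (hZ.prodMk hX).aemeasurable
  have hswap : InformationTheory.klDiv (μ.map fun ω => (Y ω, X ω)) ((μ.map Y).prod (μ.map X)) ≤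
      InformationTheory.klDiv (μ.map fun ω => (X ω, Y ω)) ((μ.map X).prod (μ.map Y)) := by
    rw [← Measure.prod_swap]
    refine le_of_eq_of_le ?_ (InformationTheory.klDiv_map_le _ _ measurable_swap)
    rw [Measure.map_map measurable_swap (hX.prodMk hY)]
    rfl
  have hswap' : InformationTheory.klDiv (μ.map fun ω => (X ω, Z ω)) ((μ.map X).prod (μ.map Z)) ≤
      InformationTheory.klDiv (μ.map fun ω => (Z ω, X ω)) ((μ.map Z).prod (μ.map X)) := by
    rw [← Measure.prod_swap]
    refine le_of_eq_of_le ?_ (InformationTheory.klDiv_map_le _ _ measurable_swap)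
    rw [Measure.map_map measurable_swap (hZ.prodMk hX)]
    rfl
  have hM : μ.map (fun ω => ((Y ω, X ω), Z ω)) =
      (μ.map fun ω => (Y ω, X ω)) ⊗ₘ (condDistrib Z Y μ).prodMkRight α := by
    rw [← condDistrib_ae_eq_iff_measure_eq_compProd _ hZ.aemeasurable]
    exact (condIndepFun_iff_condDistrib_prod_ae_eq_prodMkRight hZ hX hY).1 h
  have hM' : μ.map (fun ω => ((Z ω, X ω), Y ω)) =
      (μ.map fun ω => (Z ω, X ω)) ⊗ₘ condDistrib Y (fun ω => (Z ω, X ω)) μ :=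
    (compProd_map_condDistrib hY.aemeasurable).symm
  -- Attaching the same kernel, Z given Y, to both measures does not change their divergence.
  -- Reordering the coordinates then lets the chain rule split off Y given (Z, X) instead.
  let e : (β × α) × γ → (γ × α) × β := fun p => ((p.2, p.1.2), p.1.1)
  have he : Measurable e := by fun_prop
  have hle := InformationTheory.klDiv_map_le
    ((μ.map fun ω => (Y ω, X ω)) ⊗ₘ (condDistrib Z Y μ).prodMkRight α)
    (((μ.map Y).prod (μ.map X)) ⊗ₘ (condDistrib Z Y μ).prodMkRight α) he
  rw [InformationTheory.klDiv_compProd_left, ← hM, Measure.map_map he (by fun_prop)] at hle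
  -- Both sides are the law of (Y, Z) together with an independent copy of X.
  have hN : ((((μ.map Y).prod (μ.map X)) ⊗ₘ (condDistrib Z Y μ).prodMkRight α).map e) =
      ((μ.map Z).prod (μ.map X)) ⊗ₘ (condDistrib Y Z μ).prodMkRight α := by
    rw [compProd_prod_condDistrib hY hZ, compProd_prod_condDistrib hZ hY,
      Measure.map_map he (by fun_prop)]
    have : (μ.map fun ω => (Z ω, Y ω)) = (μ.map fun ω => (Y ω, Z ω)).map Prod.swap := by
      rw [Measure.map_map measurable_swap (hY.prodMk hZ)]
      rfl
    have h2 : ((μ.map fun ω => (Y ω, Z ω)).map Prod.swap).prod (μ.map X) =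
        ((μ.map fun ω => (Y ω, Z ω)).prod (μ.map X)).map (Prod.map Prod.swap id) := by
      rw [← Measure.map_prod_map _ _ measurable_swap measurable_id, Measure.map_id]
    rw [this, h2, Measure.map_map (by fun_prop) (by fun_prop)]
    rfl
  have hM'' : (e ∘ fun ω => ((Y ω, X ω), Z ω)) = fun ω => ((Z ω, X ω), Y ω) := rfl
  rw [hN, hM'', hM', InformationTheory.klDiv_compProd_eq_add] at hle
  by_contra hlt
  rw [not_lt] at hlt
  refine hne ?_
  rw [condIndepFun_iff_condDistrib_prod_ae_eq_prodMkRight hY hX hZ,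
    condDistrib_ae_eq_iff_measure_eq_compProd _ hY.aemeasurable, hM',
    ← InformationTheory.klDiv_eq_zero_iff]
  set I := InformationTheory.klDiv (μ.map fun ω => (X ω, Y ω)) ((μ.map X).prod (μ.map Y))
  have h1 := (add_le_add_left (hlt.trans hswap') _).trans (hle.trans hswap)
  -- `h1` reads I + D ≤ I; cancelling I is where finiteness enters.
  exact nonpos_iff_eq_zero.1 ((ENNReal.add_le_add_iff_left hfin).1 (h1.trans (add_zero I).ge))

/-- A criterion for conditional independence: the conditional probabilities of the events of `Z`
given `(Y, X)` are functions of `Y`. -/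
theorem condIndepFun_of_forall_measure_eq_setLIntegral [StandardBorelSpace Ω]
    [StandardBorelSpace α] [Nonempty α] [StandardBorelSpace γ] [Nonempty γ]
    (hX : Measurable X) (hY : Measurable Y) (hZ : Measurable Z)
    (h : ∀ u, MeasurableSet u → ∃ g : β → ℝ≥0∞, Measurable g ∧ ∀ s t, MeasurableSet s →
      MeasurableSet t → μ (Y ⁻¹' s ∩ X ⁻¹' t ∩ Z ⁻¹' u) = ∫⁻ ω in Y ⁻¹' s ∩ X ⁻¹' t, g (Y ω) ∂μ) :
    X ⟂ᵢ[Y, hY; μ] Z := by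
  have pY := Measure.isProbabilityMeasure_map (μ := μ) hY.aemeasurable
  have pYX := Measure.isProbabilityMeasure_map (μ := μ) (hY.prodMk hX).aemeasurable
  rw [condIndepFun_iff_condDistrib_prod_ae_eq_prodMkRight hZ hX hY,
    condDistrib_ae_eq_iff_measure_eq_compProd _ hZ.aemeasurable]
  have := Measure.isProbabilityMeasure_map (μ := μ) ((hY.prodMk hX).prodMk hZ).aemeasurable
  refine Measure.ext_prod₃' fun {s t u} hs ht hu => ?_
  obtain ⟨g, hg, H⟩ := h u hu
  -- Taking `t` to be the whole space identifies `g` with the conditional probability of `u` given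
  -- Y.
  have hae : g =ᵐ[μ.map Y] fun y => condDistrib Z Y μ y u := by
    refine ae_eq_of_forall_setLIntegral_eq_of_sigmaFinite hg (Kernel.measurable_coe _ hu)
      fun s hs _ => ?_
    rw [setLIntegral_map hs hg hY, ← Measure.compProd_apply_prod hs hu,
      compProd_map_condDistrib hZ.aemeasurable,
      Measure.map_apply (hY.prodMk hZ) (hs.prod hu)]
    have := H s Set.univ hs .univ
    rw [Set.preimage_univ, Set.inter_univ] at this
    rw [← this]
    rfl
  rw [Measure.map_apply (by fun_prop) ((hs.prod ht).prod hu),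
    Measure.compProd_apply_prod (hs.prod ht) hu, setLIntegral_map (hs.prod ht)
      (Kernel.measurable_coe _ hu) (hY.prodMk hX)]
  refine (H s t hs ht).trans ?_
  refine lintegral_congr_ae (ae_restrict_of_ae ?_)
  filter_upwards [ae_of_ae_map hY.aemeasurable hae] with ω hω
  simpa using hω

/-- Independent variables are conditionally independent given the trivial `σ`-algebra. -/
lemma IndepFun.condIndepFun_bot [StandardBorelSpace Ω] (hX : Measurable X) (hY : Measurable Y)
    (h : IndepFun X Y μ) : CondIndepFun ⊥ bot_le X Y μ := by
  rw [condIndepFun_iff_condExp_inter_preimage_eq_mul hX hY]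
  intro s t hs ht
  have := h.measure_inter_preimage_eq_mul s t hs ht
  simp only [condExp_bot]
  rw [integral_indicator_const _ ((hX hs).inter (hY ht)), integral_indicator_const _ (hX hs),
    integral_indicator_const _ (hY ht)]
  simp [measureReal_def, this]

end DataProcessing

/-! ### Calculus of iterated integrals -/

section IteratedIntegral

variable {V : Type*} [DecidableEq V] {E : V → Type*} [∀ v, MeasurableSpace (E v)]
  {G : Digraph V} {κ : ∀ v, Kernel (∀ u : {u // G.Adj u v}, E u) (E v)}

lemma iteratedIntegral_append (l l' : List V) (f : (∀ v, E v) → ℝ≥0∞) (x : ∀ v, E v) :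
    iteratedIntegral G κ (l ++ l') f x = iteratedIntegral G κ l (iteratedIntegral G κ l' f) x := by
  induction l generalizing x with
  | nil => rfl
  | cons v l ih => simp only [List.cons_append, iteratedIntegral, ih]

end IteratedIntegral

lemma measurable_parentValues {V : Type*} {E : V → Type*} [∀ v, MeasurableSpace (E v)]
    (G : Digraph V) (v : V) : Measurable (parentValues G E v) :=
  measurable_pi_lambda _ fun u => measurable_pi_apply u.1

lemma dependsOn_indicator_preimage {V : Type*} {E : V → Type*} {T : Set V} {v : V} (hv : v ∈ T)
    (s : Set (E v)) :
    DependsOn (((fun x : ∀ w, E w => x v) ⁻¹' s).indicator (1 : (∀ w, E w) → ℝ≥0∞)) T := by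
  intro x y h
  exact congrArg (s.indicator (1 : E v → ℝ≥0∞)) (h v hv)

section IteratedIntegral

variable {V : Type*} [DecidableEq V] {E : V → Type*} [∀ v, MeasurableSpace (E v)]
  {G : Digraph V} {κ : ∀ v, Kernel (∀ u : {u // G.Adj u v}, E u) (E v)}

lemma measurable_iteratedIntegral [∀ v, IsMarkovKernel (κ v)] (l : List V)
    {f : (∀ v, E v) → ℝ≥0∞} (hf : Measurable f) : Measurable (iteratedIntegral G κ l f) := by
  induction l with
  | nil => exact hf
  | cons v l ih =>
    have h : Measurable fun p : (∀ w, E w) × E v =>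
        iteratedIntegral G κ l f (Function.update p.1 v p.2) := ih.comp measurable_update'
    exact Measurable.lintegral_kernel_prod_right' (κ := (κ v).comap _ (measurable_parentValues G v)) h

/-- Integration removes the coordinates of `l`, and the kernels bring in only their parents. A
parent outside `D` is itself in `l`, hence earlier in the order and integrated further out. -/
lemma iteratedIntegral_dependsOn {l : List V} (hG : ∀ v, ¬ G.Adj v v)
    (hl : l.Pairwise fun a b => ¬ G.Adj b a) {f : (∀ v, E v) → ℝ≥0∞} {D : Set V}
    (hpa : ∀ v ∈ l, ∀ u, G.Adj u v → u ∈ D ∨ u ∈ l) (hf : DependsOn f (D ∪ {v | v ∈ l})) :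
    DependsOn (iteratedIntegral G κ l f) D := by
  induction l generalizing D with
  | nil => simpa [iteratedIntegral] using hf
  | cons v l ih =>
    rw [List.pairwise_cons] at hl
    have hF : DependsOn (iteratedIntegral G κ l f) (insert v D) := by
      refine ih hl.2 (fun w hw u hu => ?_) (hf.mono fun w hw => ?_)
      · rcases hpa w (List.mem_cons_of_mem _ hw) u hu with h | h
        · exact .inl (.inr h)
        · rcases List.mem_cons.1 h with rfl | h
          · exact .inl (.inl rfl)
          · exact .inr h
      · rcases hw with h | h
        · exact .inl (.inr h)
        · rcases List.mem_cons.1 h with rfl | h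
          · exact .inl (.inl rfl)
          · exact .inr h
    intro x y hxy
    have hpar : parentValues G E v x = parentValues G E v y := by
      funext u
      refine hxy _ ?_
      rcases hpa v List.mem_cons_self u u.2 with h | h
      · exact h
      · rcases List.mem_cons.1 h with h | h
        · have hu := u.2
          rw [h] at hu
          exact absurd hu (hG v)
        · exact absurd u.2 (hl.1 _ h)
    simp only [iteratedIntegral, hpar]
    refine lintegral_congr fun z => hF fun i hi => ?_
    by_cases h : i = v
    · subst h; simp
    · simpa [h] using hxy i (hi.resolve_left h)

lemma iteratedIntegral_mul [∀ v, IsMarkovKernel (κ v)] {l : List V}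
    {f h : (∀ v, E v) → ℝ≥0∞} (hf : Measurable f) (hh : DependsOn h {v | v ∉ l}) (x : ∀ v, E v) :
    iteratedIntegral G κ l (fun x => h x * f x) x = h x * iteratedIntegral G κ l f x := by
  induction l generalizing x with
  | nil => rfl
  | cons v l ih =>
    simp only [iteratedIntegral]
    have hm : Measurable fun y => iteratedIntegral G κ l f (Function.update x v y) :=
      (measurable_iteratedIntegral l hf).comp (measurable_update x)
    rw [← lintegral_const_mul _ hm]
    refine lintegral_congr fun y => ?_
    rw [ih (hh.mono fun w (hw : w ∉ v :: l) (h' : w ∈ l) => hw (List.mem_cons_of_mem _ h'))]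
    congr 1
    refine hh fun i hi => Function.update_of_ne ?_ _ _
    rintro rfl
    exact hi List.mem_cons_self

lemma iteratedIntegral_one [∀ v, IsMarkovKernel (κ v)] (l : List V) (x : ∀ v, E v) :
    iteratedIntegral G κ l (fun _ => 1) x = 1 := by
  induction l generalizing x with
  | nil => rfl
  | cons v l ih => simp [iteratedIntegral, ih]

lemma iteratedIntegral_of_dependsOn [∀ v, IsMarkovKernel (κ v)] {l : List V}
    {h : (∀ v, E v) → ℝ≥0∞} (hh : DependsOn h {v | v ∉ l}) (x : ∀ v, E v) :
    iteratedIntegral G κ l h x = h x := by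
  have := iteratedIntegral_mul (G := G) (κ := κ) (f := fun _ => 1) measurable_const hh x
  simpa [iteratedIntegral_one] using this

end IteratedIntegral

/-! ### Ancestral sets and the factorization -/

section Separation

variable {V : Type*} {G : Digraph V}

/-- The parents of the nodes of `T` belong to `T`. -/
def IsAncestral (G : Digraph V) (T : Set V) : Prop :=
  ∀ u v, G.Adj u v → v ∈ T → u ∈ T

lemma Digraph.IsDAG.irrefl (hG : G.IsDAG) (v : V) : ¬ G.Adj v v :=
  fun h => hG v (.single h)

lemma Digraph.IsDAG.asymm (hG : G.IsDAG) {u v : V} (h : G.Adj u v) : ¬ G.Adj v u :=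
  fun h' => hG u (.tail (.single h) h')

lemma Digraph.IsDAG.exists_isTopologicalOrder [Fintype V] (hG : G.IsDAG) :
    ∃ l, IsTopologicalOrder G l := by
  classical
  -- Acyclicity is antisymmetry of reachability; sorting by a linear extension gives the order.
  have : IsPartialOrder V (Relation.ReflTransGen G.Adj) :=
    { refl := fun _ => .refl
      trans := fun _ _ _ => .trans
      antisymm := fun a b hab hba => by
        rcases Relation.reflTransGen_iff_eq_or_transGen.1 hab with h | h
        · exact h.symm
        · exact absurd (h.trans_left hba) (hG a) }
  obtain ⟨s, hs, hle⟩ := extend_partialOrder (Relation.ReflTransGen G.Adj)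
  refine ⟨Finset.univ.sort s, Finset.sort_nodup _ _, fun v => by simp, ?_⟩
  refine ((Finset.pairwise_sort Finset.univ s).and (Finset.sort_nodup Finset.univ s)).imp ?_
  rintro a b ⟨hab, hne⟩ hba
  exact hne (antisymm_of s hab (hle _ _ (.single hba)))

/-- Filtering preserves the order within each block, and ancestrality of `T` and `T ∪ S` forbids
edges from a later block to an earlier one. -/
lemma exists_append_isTopologicalOrder [Fintype V] (hG : G.IsDAG) {T S : Set V}
    (hTS : Disjoint T S) (hT : IsAncestral G T) (hU : IsAncestral G (T ∪ S)) :
    ∃ l₁ l₂ l₃, IsTopologicalOrder G (l₁ ++ (l₂ ++ l₃)) ∧ (∀ v, v ∈ l₁ ↔ v ∈ T) ∧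
      (∀ v, v ∈ l₂ ↔ v ∈ S) ∧ ∀ v, v ∈ l₃ ↔ v ∉ T ∪ S := by
  classical
  obtain ⟨l, hnd, hmem, hl⟩ := hG.exists_isTopologicalOrder
  refine ⟨l.filter (· ∈ T), l.filter (· ∈ S), l.filter (· ∉ T ∪ S), ⟨?_, ?_, ?_⟩,
    by simp [hmem], by simp [hmem], by simp [hmem]⟩
  · simp only [List.nodup_append, List.mem_append, List.mem_filter, decide_eq_true_eq]
    refine ⟨hnd.filter _, ⟨hnd.filter _, hnd.filter _, ?_⟩, ?_⟩
    · rintro a ⟨-, ha⟩ _ ⟨-, hb⟩ rfl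
      exact hb (.inr ha)
    · rintro a ⟨-, ha⟩ _ (⟨-, hb⟩ | ⟨-, hb⟩) rfl
      · exact hTS.notMem_of_mem_left ha hb
      · exact hb (.inl ha)
  · intro v
    simp only [List.mem_append, List.mem_filter, hmem, decide_eq_true_eq, true_and]
    by_cases h1 : v ∈ T
    · exact .inl h1
    · by_cases h2 : v ∈ S
      · exact .inr (.inl h2)
      · exact .inr (.inr fun h => h.elim h1 h2)
  · simp only [List.pairwise_append, List.mem_append, List.mem_filter, decide_eq_true_eq]
    refine ⟨hl.filter _, ⟨hl.filter _, hl.filter _, ?_⟩, ?_⟩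
    · rintro a ⟨-, ha⟩ b ⟨-, hb⟩ hba
      exact hb (hU _ _ hba (.inr ha))
    · rintro a ⟨-, ha⟩ b hb hba
      have := hT _ _ hba ha
      rcases hb with ⟨-, hb⟩ | ⟨-, hb⟩
      · exact hTS.notMem_of_mem_left this hb
      · exact hb (.inl this)

variable [Fintype V] [DecidableEq V] {E : V → Type*} [∀ v, MeasurableSpace (E v)]

/-- If all parents of the nodes of `S` are in `S ∪ C`, then the values of the nodes of `T ⊇ C`
influence those of the nodes of `S` only through the values of the nodes of `C`. -/
theorem Factorizes.exists_lintegral_mul_eq {P : Measure (∀ v, E v)} [IsProbabilityMeasure P]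
    (hG : G.IsDAG) (hP : Factorizes G P) {T S C : Set V} (hTS : Disjoint T S)
    (hT : IsAncestral G T) (hU : IsAncestral G (T ∪ S)) (hCT : C ⊆ T)
    (hpa : ∀ v ∈ S, ∀ u, G.Adj u v → u ∈ C ∨ u ∈ S) {g : (∀ v, E v) → ℝ≥0∞} (hg : Measurable g)
    (hgS : DependsOn g S) :
    ∃ g' : (∀ v, E v) → ℝ≥0∞, Measurable g' ∧ DependsOn g' C ∧
      ∀ h : (∀ v, E v) → ℝ≥0∞, Measurable h → DependsOn h T →
        ∫⁻ x, h x * g x ∂P = ∫⁻ x, h x * g' x ∂P := by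
  obtain ⟨κ, hκ, -, H⟩ := hP
  obtain ⟨l₁, l₂, l₃, hl, -, h₂, h₃⟩ := exists_append_isTopologicalOrder hG hTS hT hU
  have hl₂ : l₂.Pairwise fun a b => ¬ G.Adj b a :=
    (List.pairwise_append.1 (List.pairwise_append.1 hl.2.2).2.1).1
  have hg' : DependsOn (iteratedIntegral G κ l₂ g) C := by
    refine iteratedIntegral_dependsOn hG.irrefl hl₂ ?_ (hgS.mono fun v hv => .inr ((h₂ v).2 hv))
    simpa only [h₂] using hpa
  -- The witness is `g` with the nodes of `S` integrated out. In both integrals the nodes outside `T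
  -- ∪ S` integrate to one; integrating over `S` then leaves the same function of `T`.
  refine ⟨_, measurable_iteratedIntegral l₂ hg, hg', fun h hh hhT => ?_⟩
  have hm := measurable_iteratedIntegral (G := G) (κ := κ) l₂ hg
  have x₀ : ∀ v, E v := (nonempty_of_isProbabilityMeasure P).some
  rw [H _ hl (fun x => h x * g x) (hh.mul hg) x₀,
    H _ hl (fun x => h x * iteratedIntegral G κ l₂ g x) (hh.mul hm) x₀,
    iteratedIntegral_append, iteratedIntegral_append]
  congr 1
  funext x
  have e₃ : ∀ {f : (∀ v, E v) → ℝ≥0∞}, DependsOn f (T ∪ S) → iteratedIntegral G κ l₃ f = f :=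
    fun hf => funext fun x => iteratedIntegral_of_dependsOn
      (hf.mono fun v hv hv' => (h₃ v).1 hv' hv) x
  have e₂ : ∀ {f : (∀ v, E v) → ℝ≥0∞}, DependsOn f T → DependsOn f {v | v ∉ l₂} :=
    fun hf => hf.mono fun v hv hv' => hTS.notMem_of_mem_left hv ((h₂ v).1 hv')
  have hmul : ∀ {f f' : (∀ v, E v) → ℝ≥0∞} {D D' : Set V}, DependsOn f D → DependsOn f' D' →
      DependsOn (fun x => f x * f' x) (D ∪ D') := fun hf hf' x y hxy =>
    congrArg₂ (· * ·) (hf fun i hi => hxy i (.inl hi)) (hf' fun i hi => hxy i (.inr hi))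
  have hhg' : DependsOn (fun x => h x * iteratedIntegral G κ l₂ g x) T :=
    (hmul hhT hg').mono (Set.union_subset subset_rfl hCT)
  rw [iteratedIntegral_append, iteratedIntegral_append, e₃ (hmul hhT hgS),
    e₃ (hhg'.mono Set.subset_union_left), iteratedIntegral_mul hg (e₂ hhT),
    iteratedIntegral_of_dependsOn (e₂ hhg')]

end Separation

/-! ### Independence of nodes from separation by ancestral sets -/

section NodeIndependence

variable {V : Type*} [Fintype V] [DecidableEq V] {E : V → Type*} [∀ v, MeasurableSpace (E v)]
  {G : Digraph V} {P : Measure (∀ v, E v)} [IsProbabilityMeasure P]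

theorem Factorizes.indepFun (hG : G.IsDAG) (hP : Factorizes G P) {T S : Set V}
    (hTS : Disjoint T S) (hT : IsAncestral G T) (hS : IsAncestral G S) {a b : V} (ha : a ∈ T)
    (hb : b ∈ S) : IndepFun (fun x => x a) (fun x => x b) P := by
  rw [indepFun_iff_measure_inter_preimage_eq_mul]
  intro t u ht hu
  have mt : MeasurableSet ((fun x : ∀ w, E w => x a) ⁻¹' t) := measurable_pi_apply a ht
  have mu : MeasurableSet ((fun x : ∀ w, E w => x b) ⁻¹' u) := measurable_pi_apply b hu
  have hU : IsAncestral G (T ∪ S) := fun v w hvw hw => hw.imp (hT v w hvw) (hS v w hvw)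
  obtain ⟨g', -, hg', H⟩ := hP.exists_lintegral_mul_eq hG hTS hT hU (Set.empty_subset T)
    (fun v hv w hw => .inr (hS w v hw hv)) (measurable_one.indicator mu)
    (dependsOn_indicator_preimage hb u)
  obtain ⟨x₀⟩ := nonempty_of_isProbabilityMeasure P
  -- Nothing links `S` to `T`, so `g'` is a constant; testing against `h = 1` shows that it is the
  -- probability of the event at `b`.
  have hconst : ∀ x, g' x = g' x₀ := fun x => hg'.empty x x₀
  have h1 := H 1 measurable_one (fun _ _ _ => rfl)
  have h2 := H _ (measurable_one.indicator mt) (dependsOn_indicator_preimage ha t)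
  simp only [hconst, Pi.one_apply, one_mul, lintegral_indicator_one mu, lintegral_const,
    measure_univ, mul_one] at h1
  rw [h1, ← lintegral_indicator_one (mt.inter mu), Set.inter_indicator_one]
  refine h2.trans ?_
  simp only [hconst]
  rw [lintegral_mul_const _ (measurable_one.indicator mt), lintegral_indicator_one mt]

variable [∀ v, StandardBorelSpace (E v)]

/-- The only parent from outside `S` is `c`, so integrating out `S` leaves a function of the value
at `c`: the conditional probability of an event at `b`. -/
theorem Factorizes.condIndepFun (hG : G.IsDAG) (hP : Factorizes G P) {S : Set V} {c : V}
    (hc : c ∉ S) (hSc : IsAncestral G Sᶜ) (hS : ∀ v ∈ S, ∀ u, G.Adj u v → u = c ∨ u ∈ S) {a b : V}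
    (ha : a ∉ S) (hb : b ∈ S) :
    (fun x : ∀ w, E w => x a) ⟂ᵢ[fun x => x c, measurable_pi_apply c; P] fun x => x b := by
  obtain ⟨x₀⟩ := nonempty_of_isProbabilityMeasure P
  have : ∀ v, Nonempty (E v) := fun v => ⟨x₀ v⟩
  refine condIndepFun_of_forall_measure_eq_setLIntegral (measurable_pi_apply a)
    (measurable_pi_apply c) (measurable_pi_apply b) fun u hu => ?_
  have mu : MeasurableSet ((fun x : ∀ w, E w => x b) ⁻¹' u) := measurable_pi_apply b hu
  obtain ⟨g', hm, hg', H⟩ := hP.exists_lintegral_mul_eq hG (disjoint_compl_left (a := S)) hSc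
    (by rw [Set.compl_union_self]; exact fun _ _ _ _ => trivial)
    (Set.singleton_subset_iff.2 (Set.mem_compl hc))
    hS (measurable_one.indicator mu)
    (dependsOn_indicator_preimage hb u)
  refine ⟨fun y => g' (Function.update x₀ c y), hm.comp (measurable_update x₀),
    fun s t hs ht => ?_⟩
  have ms : MeasurableSet ((fun x : ∀ w, E w => x c) ⁻¹' s) := measurable_pi_apply c hs
  have mt : MeasurableSet ((fun x : ∀ w, E w => x a) ⁻¹' t) := measurable_pi_apply a ht
  have hg : ∀ x, g' (Function.update x₀ c (x c)) = g' x := fun x => hg' fun i hi => by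
    rw [Set.mem_singleton_iff.1 hi, Function.update_self]
  simp only [hg]
  rw [← lintegral_indicator_one ((ms.inter mt).inter mu), Set.inter_indicator_one,
    ← lintegral_indicator (ms.inter mt)]
  refine (H _ (measurable_one.indicator (ms.inter mt)) ?_).trans (lintegral_congr fun x => ?_)
  · rw [Set.inter_indicator_one]
    intro x y h
    simp only [Pi.mul_apply, dependsOn_indicator_preimage (Set.mem_compl ha) t h,
      dependsOn_indicator_preimage (Set.mem_compl hc) s h]
  · rw [← Set.indicator_mul_const]
    simp only [Pi.one_apply, one_mul]
    rfl

end NodeIndependence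

/-! ### From sets of nodes to single variables -/

section CondIndepNodes

variable {V : Type*} {E : V → Type*} [∀ v, MeasurableSpace (E v)]

lemma comap_restrict_singleton (a : V) :
    MeasurableSpace.comap (Finset.restrict (π := E) {a}) inferInstance =
      MeasurableSpace.comap (fun x : ∀ w, E w => x a) inferInstance := by
  refine le_antisymm (measurable_iff_comap_le.1
    ((@measurable_pi_iff _ _ _ (MeasurableSpace.comap _ _) _ _).2 ?_)) ?_
  · rintro ⟨i, hi⟩
    obtain rfl := Finset.mem_singleton.1 hi
    exact comap_measurable _
  · rw [← measurable_iff_comap_le]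
    exact (measurable_pi_apply (⟨a, Finset.mem_singleton_self a⟩ : ({a} : Finset V))).comp
      (comap_measurable (Finset.restrict (π := E) {a}))

lemma comap_restrict_empty :
    MeasurableSpace.comap (Finset.restrict (π := E) ∅) inferInstance = ⊥ := by
  refine eq_bot_iff.2 (measurable_iff_comap_le.1 ((@measurable_pi_iff _ _ _ ⊥ _ _).2 ?_))
  rintro ⟨i, hi⟩
  simp at hi

variable [Countable V] [∀ v, StandardBorelSpace (E v)] {P : Measure (∀ v, E v)}

lemma condIndepNodes_singleton [IsFiniteMeasure P] {a b c : V} :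
    CondIndepNodes P {a} {b} {c} ↔
      (fun x : ∀ w, E w => x a) ⟂ᵢ[fun x => x c, measurable_pi_apply c; P] fun x => x b := by
  simp only [CondIndepNodes, condIndepFun_iff_condIndep, comap_restrict_singleton]

lemma condIndepNodes_empty [IsProbabilityMeasure P] {a b : V}
    (h : IndepFun (fun x : ∀ w, E w => x a) (fun x => x b) P) : CondIndepNodes P {a} {b} ∅ := by
  have := IndepFun.condIndepFun_bot (measurable_pi_apply a) (measurable_pi_apply b) h
  rw [condIndepFun_iff_condIndep] at this
  simpa only [CondIndepNodes, condIndepFun_iff_condIndep, comap_restrict_singleton,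
    comap_restrict_empty] using this

lemma mutualInfo_eq_zero_iff {V : Type*} {E : V → Type*} [∀ v, MeasurableSpace (E v)]
    {P : Measure (∀ v, E v)} [IsProbabilityMeasure P] {a b : V} :
    mutualInfo P a b = 0 ↔ IndepFun (fun x : ∀ w, E w => x a) (fun x => x b) P := by
  have ma := measurable_pi_apply (X := E) a
  have mb := measurable_pi_apply (X := E) b
  have := Measure.isProbabilityMeasure_map (μ := P) ma.aemeasurable
  have := Measure.isProbabilityMeasure_map (μ := P) mb.aemeasurable
  have := Measure.isProbabilityMeasure_map (μ := P) (ma.prodMk mb).aemeasurable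
  rw [mutualInfo, InformationTheory.klDiv_eq_zero_iff,
    indepFun_iff_map_prod_eq_prod_map_map ma.aemeasurable mb.aemeasurable]

end CondIndepNodes

/-! ### Trails, bridges and active segments -/

section Trails

variable {V : Type*} {G : Digraph V}

lemma Digraph.skeleton_adj {u v : V} :
    G.skeleton.Adj u v ↔ u ≠ v ∧ (G.Adj u v ∨ G.Adj v u) :=
  SimpleGraph.fromRel_adj _ _ _

lemma Digraph.IsDAG.skeleton_adj (hG : G.IsDAG) {u v : V} (h : G.Adj u v) :
    G.skeleton.Adj u v :=
  Digraph.skeleton_adj.2 ⟨fun e => hG.irrefl v (e ▸ h), .inl h⟩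

/-- A bridge `c → d` separates the nodes on the side of `d` from the others. -/
lemma bridge_separates (hG : G.IsDAG) {c d : V} (hcd : G.Adj c d)
    (hb : G.skeleton.IsBridge s(c, d)) :
    IsAncestral G {v | (G.skeleton.deleteEdges {s(c, d)}).Reachable d v}ᶜ ∧
      ∀ v, (G.skeleton.deleteEdges {s(c, d)}).Reachable d v → ∀ u, G.Adj u v →
        u = c ∨ (G.skeleton.deleteEdges {s(c, d)}).Reachable d u := by
  have hc : ¬ (G.skeleton.deleteEdges {s(c, d)}).Reachable d c := fun h =>
    SimpleGraph.isBridge_iff.1 hb h.symm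
  have key : ∀ u v, G.Adj u v → s(u, v) ≠ s(c, d) →
      (G.skeleton.deleteEdges {s(c, d)}).Adj u v := fun u v h hne =>
    SimpleGraph.deleteEdges_adj.2 ⟨hG.skeleton_adj h, hne⟩
  constructor
  · intro u v huv hv hu
    by_cases h : s(u, v) = s(c, d)
    · rcases Sym2.eq_iff.1 h with ⟨rfl, rfl⟩ | ⟨rfl, rfl⟩
      · exact hv .rfl
      · exact hG.asymm hcd huv
    · exact hv (SimpleGraph.Reachable.trans hu (key u v huv h).reachable)
  · intro v hv u huv
    by_cases h : s(u, v) = s(c, d)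
    · rcases Sym2.eq_iff.1 h with ⟨rfl, rfl⟩ | ⟨rfl, rfl⟩
      · exact .inl rfl
      · exact absurd hv hc
    · exact .inr (hv.trans (key u v huv h).reachable.symm)

/-- Two bridges `a → m ← b` separate the side of `a` from that of `b`. -/
lemma collider_separates (hG : G.IsDAG) {a b m : V} (ham : G.Adj a m) (hbm : G.Adj b m)
    (hab : a ≠ b) (ha : G.skeleton.IsBridge s(a, m)) (hb : G.skeleton.IsBridge s(b, m)) :
    let H := G.skeleton.deleteEdges {s(a, m), s(b, m)}
    Disjoint {v | H.Reachable a v} {v | H.Reachable b v} ∧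
      IsAncestral G {v | H.Reachable a v} ∧ IsAncestral G {v | H.Reachable b v} := by
  intro H
  have hHa : H ≤ G.skeleton.deleteEdges {s(a, m)} :=
    SimpleGraph.deleteEdges_anti (by simp)
  have hHb : H ≤ G.skeleton.deleteEdges {s(b, m)} :=
    SimpleGraph.deleteEdges_anti (by simp)
  have hma : ¬ H.Reachable a m := fun h => SimpleGraph.isBridge_iff.1 ha (h.mono hHa)
  have hmb : ¬ H.Reachable b m := fun h => SimpleGraph.isBridge_iff.1 hb (h.mono hHb)
  have hanc : ∀ r, ¬ H.Reachable r m → IsAncestral G {v | H.Reachable r v} := by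
    intro r hr u v huv hv
    by_cases h : s(u, v) ∈ ({s(a, m), s(b, m)} : Set (Sym2 V))
    · simp only [Set.mem_insert_iff, Set.mem_singleton_iff, Sym2.eq_iff] at h
      rcases h with (⟨-, rfl⟩ | ⟨rfl, rfl⟩) | (⟨-, rfl⟩ | ⟨rfl, rfl⟩)
      · exact absurd hv hr
      · exact absurd huv (hG.asymm ham)
      · exact absurd hv hr
      · exact absurd huv (hG.asymm hbm)
    · exact SimpleGraph.Reachable.trans hv
        (SimpleGraph.deleteEdges_adj.2 ⟨hG.skeleton_adj huv, h⟩ : H.Adj u v).reachable.symm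
  refine ⟨Set.disjoint_left.2 fun v hva hvb => ?_, hanc a hma, hanc b hmb⟩
  -- If the two sides met, passing from `a` to `b` and along `b → m` would avoid the bridge between
  -- `a` and `m`.
  have h1 : H.Reachable a b := SimpleGraph.Reachable.trans hva (SimpleGraph.Reachable.symm hvb)
  have h2 : (G.skeleton.deleteEdges {s(a, m)}).Adj b m := by
    refine SimpleGraph.deleteEdges_adj.2 ⟨hG.skeleton_adj hbm, fun h => ?_⟩
    rcases Sym2.eq_iff.1 h with ⟨h, -⟩ | ⟨h, -⟩
    · exact hab h.symm
    · exact hG.irrefl m (h ▸ hbm)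
  exact SimpleGraph.isBridge_iff.1 ha ((h1.mono hHa).trans h2.reachable)

lemma SimpleGraph.Walk.reachable_deleteEdges_getVert {H : SimpleGraph V} {u v : V}
    (p : H.Walk u v) {s : Set (Sym2 V)} {i j : ℕ} (hij : i ≤ j) (hj : j ≤ p.length)
    (hs : ∀ k, i ≤ k → k < j → s(p.getVert k, p.getVert (k + 1)) ∉ s) :
    (H.deleteEdges s).Reachable (p.getVert i) (p.getVert j) := by
  induction j, hij using Nat.le_induction with
  | base => rfl
  | succ j hij ih =>
    refine (ih (by omega) fun k h1 h2 => hs k h1 (by omega)).trans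
      (SimpleGraph.Adj.reachable ?_)
    exact SimpleGraph.deleteEdges_adj.2 ⟨p.adj_getVert_succ (by omega), hs j hij (by omega)⟩

lemma SimpleGraph.Walk.IsPath.getVert_eq_iff {H : SimpleGraph V} {u v : V} {p : H.Walk u v}
    (hp : p.IsPath) {i j : ℕ} (hi : i ≤ p.length) (hj : j ≤ p.length) :
    p.getVert i = p.getVert j ↔ i = j :=
  hp.getVert_injOn.eq_iff hi hj

lemma SimpleGraph.Walk.IsPath.edge_eq_iff {H : SimpleGraph V} {u v : V} {p : H.Walk u v}
    (hp : p.IsPath) {i j : ℕ} (hi : i < p.length) (hj : j < p.length) :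
    s(p.getVert i, p.getVert (i + 1)) = s(p.getVert j, p.getVert (j + 1)) ↔ i = j := by
  rw [Sym2.eq_iff, hp.getVert_eq_iff (by omega) (by omega), hp.getVert_eq_iff (by omega) (by omega),
    hp.getVert_eq_iff (by omega) (by omega), hp.getVert_eq_iff (by omega) (by omega)]
  omega

/-- The skeleton is connected with one edge fewer than nodes, hence a tree, and paths in a tree are
unique. -/
lemma IsTrailGraph.isUniqueTrail [Finite V] {u v : V} {p : G.skeleton.Walk u v} (hp : p.IsPath)
    (h : IsTrailGraph G p) : IsUniqueTrail G p := by
  classical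
  have := Fintype.ofFinite V
  have hV : Nat.card V = p.length + 1 := by
    rw [← p.length_support, ← List.toFinset_card_of_nodup hp.support_nodup,
      Nat.card_eq_fintype_card, ← Finset.card_univ]
    congr 1
    ext w
    simp [h.1 w]
  have hE : Nat.card G.skeleton.edgeSet = p.length := by
    have : G.skeleton.edgeSet = p.edges.toFinset := by
      ext e
      simpa using ⟨h.2 e, fun he => p.edges_subset_edgeSet he⟩
    rw [this, Nat.card_coe_set_eq, Set.ncard_coe_finset,
      List.toFinset_card_of_nodup hp.isTrail.edges_nodup, p.length_edges]
  have hreach : ∀ w, G.skeleton.Reachable u w := fun w => (p.takeUntil w (h.1 w)).reachable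
  have hconn : G.skeleton.Connected :=
    { preconnected := fun a b => (hreach a).symm.trans (hreach b), nonempty := ⟨u⟩ }
  have htree := SimpleGraph.isTree_iff_connected_and_card.2 ⟨hconn, by rw [hV, hE]⟩
  intro k _ q hq
  exact congrArg Subtype.val
    ((htree.isAcyclic.subsingleton_path _ _).elim ⟨q, hq⟩ ⟨p.take k, hp.take k⟩)

/-- Otherwise, following the trail to `xᵢ` and then a detour around the edge would produce a path to
`xᵢ₊₁` avoiding it, unlike the initial segment. -/
lemma IsUniqueTrail.isBridge {u v : V} {p : G.skeleton.Walk u v} (hp : p.IsPath)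
    (h : IsUniqueTrail G p) {i : ℕ} (hi : i < p.length) :
    G.skeleton.IsBridge s(p.getVert i, p.getVert (i + 1)) := by
  rw [SimpleGraph.isBridge_iff]
  intro hr
  have h0 := p.reachable_deleteEdges_getVert (s := {s(p.getVert i, p.getVert (i + 1))})
    (Nat.zero_le i) hi.le fun k _ hk => by
      rw [Set.mem_singleton_iff, hp.edge_eq_iff (by omega) hi]; omega
  rw [p.getVert_zero] at h0
  obtain ⟨q, hq⟩ := (h0.trans hr).exists_isPath
  have hq' := h (i + 1) hi (q.mapLe (SimpleGraph.deleteEdges_le _)) (hq.mapLe _)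
  have hmem : s(p.getVert i, p.getVert (i + 1)) ∈ (p.take (i + 1)).edges := by
    refine (p.take (i + 1)).mk_mem_edges_iff_exists.2 ⟨i, ?_, ?_⟩
    · rw [SimpleGraph.Walk.take_length]; omega
    · simp [SimpleGraph.Walk.take_getVert]
  rw [← hq', SimpleGraph.Walk.edges_mapLe_eq_edges] at hmem
  have := q.edges_subset_edgeSet hmem
  simp [SimpleGraph.edgeSet_deleteEdges] at this

lemma IsCollider.of_take {u v : V} {p : G.skeleton.Walk u v} {k j : ℕ}
    (h : IsCollider G (p.take k) j) : j < k ∧ IsCollider G p j := by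
  obtain ⟨h0, hj, h1, h2⟩ := h
  rw [SimpleGraph.Walk.take_length] at hj
  simp only [SimpleGraph.Walk.take_getVert] at h1 h2
  rw [min_eq_right (by omega), min_eq_right (by omega)] at h1 h2
  exact ⟨by omega, h0, by omega, h1, h2⟩

lemma isActive_take {u v : V} {p : G.skeleton.Walk u v} {k : ℕ}
    (hcol : ∀ j < k, ¬ IsCollider G p j) {Z : Finset V} (hZ : ∀ j ≤ k, p.getVert j ∉ Z) :
    IsActive G (p.take k) Z := by
  refine ⟨fun j _ h => absurd h.of_take.2 (hcol j h.of_take.1), fun j hj _ => ?_⟩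
  rw [SimpleGraph.Walk.take_getVert]
  exact hZ _ (min_le_left _ _)

end Trails

/-! ### Mutual information along the trail -/

section MutualInfo

variable {V : Type*} [Fintype V] [DecidableEq V] {E : V → Type*} [∀ v, MeasurableSpace (E v)]
  {G : Digraph V} {P : Measure (∀ v, E v)} [IsProbabilityMeasure P] {x y : V}
  {p : G.skeleton.Walk x y}

/-- The first node of a trail is independent of the nodes beyond a collider. -/
theorem mutualInfo_eq_zero_of_isCollider (hG : G.IsDAG) (hP : Factorizes G P) (hp : p.IsPath)
    (hu : IsUniqueTrail G p) {m j : ℕ} (hm : IsCollider G p m) (hmj : m < j)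
    (hj : j ≤ p.length) : mutualInfo P x (p.getVert j) = 0 := by
  obtain ⟨h0, hlt, hl, hr⟩ := hm
  obtain ⟨n, rfl⟩ : ∃ n, m = n + 1 := ⟨m - 1, by omega⟩
  rw [Nat.add_sub_cancel] at hl
  have hb1 := hu.isBridge hp (i := n) (by omega)
  have hb2 := hu.isBridge hp hlt
  rw [Sym2.eq_swap] at hb2
  have hne : p.getVert n ≠ p.getVert (n + 1 + 1) := by
    rw [Ne, hp.getVert_eq_iff (by omega) (by omega)]; omega
  obtain ⟨hd, hA, hB⟩ := collider_separates hG hl hr hne hb1 hb2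
  have hnot : ∀ k, k < p.length → k ≠ n → k ≠ n + 1 → s(p.getVert k, p.getVert (k + 1)) ∉
      ({s(p.getVert n, p.getVert (n + 1)), s(p.getVert (n + 1 + 1), p.getVert (n + 1))} :
        Set (Sym2 V)) := by
    intro k hk h1 h2
    rw [Set.mem_insert_iff, Set.mem_singleton_iff, Sym2.eq_swap (a := p.getVert (n + 1 + 1)),
      hp.edge_eq_iff hk (by omega), hp.edge_eq_iff hk hlt]
    omega
  rw [mutualInfo_eq_zero_iff]
  refine hP.indepFun hG hd hA hB ?_ ?_
  · have := p.reachable_deleteEdges_getVert (Nat.zero_le n) (by omega)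
      fun k _ hk => hnot k (by omega) (by omega) (by omega)
    rw [p.getVert_zero] at this
    exact this.symm
  · exact p.reachable_deleteEdges_getVert (by omega) hj
      fun k h1 hk => hnot k (by omega) (by omega) (by omega)

variable [∀ v, StandardBorelSpace (E v)]

/-- The nodes before and after a node of a trail which is no collider are independent given that
node. -/
theorem condIndepFun_of_not_isCollider (hG : G.IsDAG) (hP : Factorizes G P) (hp : p.IsPath)
    (hu : IsUniqueTrail G p) {k : ℕ} (h0 : 0 < k) (hk : k < p.length) (hcol : ¬ IsCollider G p k) :
    (fun z : ∀ w, E w => z x) ⟂ᵢ[fun z => z (p.getVert k), measurable_pi_apply _; P]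
      fun z => z (p.getVert (k + 1)) := by
  obtain ⟨n, rfl⟩ : ∃ n, k = n + 1 := ⟨k - 1, by omega⟩
  have hb1 := hu.isBridge hp (i := n) (by omega)
  have hb2 := hu.isBridge hp hk
  have hadj1 := (Digraph.skeleton_adj.1 (p.adj_getVert_succ (i := n) (by omega))).2
  -- Some edge at `xₖ` points away from it. If it leads to `xₖ₊₁`, the set cut off is the side of
  -- `xₖ₊₁`; otherwise it leads to `xₖ₋₁`, the side containing `x` is cut off, and the roles are
  -- exchanged by symmetry.
  rcases (Digraph.skeleton_adj.1 (p.adj_getVert_succ hk)).2 with h | h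
  · obtain ⟨hT, hS⟩ := bridge_separates hG h hb2
    refine hP.condIndepFun hG (fun hr => SimpleGraph.isBridge_iff.1 hb2
      (SimpleGraph.Reachable.symm hr)) hT hS (fun hr => ?_) (SimpleGraph.Reachable.refl _)
    have := p.reachable_deleteEdges_getVert (s := {s(p.getVert (n + 1), p.getVert (n + 1 + 1))})
      (Nat.zero_le (n + 1)) hk.le fun k _ hk' => by
        rw [Set.mem_singleton_iff, hp.edge_eq_iff (by omega) hk]; omega
    rw [p.getVert_zero] at this
    exact SimpleGraph.isBridge_iff.1 hb2 (SimpleGraph.Reachable.trans hr this).symm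
  · have h' : G.Adj (p.getVert (n + 1)) (p.getVert n) :=
      hadj1.resolve_left fun h1 => hcol ⟨h0, hk, h1, h⟩
    rw [Sym2.eq_swap] at hb1
    obtain ⟨hT, hS⟩ := bridge_separates hG h' hb1
    have hnot : ∀ k, k < p.length → k ≠ n → s(p.getVert k, p.getVert (k + 1)) ∉
        ({s(p.getVert (n + 1), p.getVert n)} : Set (Sym2 V)) := by
      intro k hk' hkn
      rwa [Set.mem_singleton_iff, Sym2.eq_swap (a := p.getVert (n + 1)),
        hp.edge_eq_iff hk' (by omega)]
    refine CondIndepFun.symm (hP.condIndepFun hG (fun hr => SimpleGraph.isBridge_iff.1 hb1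
      (SimpleGraph.Reachable.symm hr)) hT hS (fun hr => ?_) ?_)
    · have := p.reachable_deleteEdges_getVert (Nat.le_succ (n + 1)) hk
        fun k h1 h2 => hnot k (by omega) (by omega)
      exact SimpleGraph.isBridge_iff.1 hb1 (this.trans (SimpleGraph.Reachable.symm hr))
    · have := p.reachable_deleteEdges_getVert (Nat.zero_le n) (by omega)
        fun k h1 h2 => hnot k (by omega) (by omega)
      rw [p.getVert_zero] at this
      exact this.symm

/-- The mutual information with the first node strictly decreases along a trail up to the node
after its first collider. -/
theorem mutualInfo_succ_lt (hG : G.IsDAG) (hP : Factorizes G P) (hfaithful : Faithful G P)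
    (hp : p.IsPath) (hu : IsUniqueTrail G p) {k : ℕ} (h0 : 0 < k) (hk : k < p.length)
    (hcol : ∀ j < k, ¬ IsCollider G p j) (hfin : mutualInfo P x (p.getVert k) ≠ ∞) :
    mutualInfo P x (p.getVert (k + 1)) < mutualInfo P x (p.getVert k) := by
  have hne : ∀ {i j}, i ≤ p.length → j ≤ p.length → i ≠ j → p.getVert i ≠ p.getVert j :=
    fun hi hj => mt (hp.getVert_eq_iff hi hj).1
  have hx : ∀ {j}, 0 < j → j ≤ p.length → x ≠ p.getVert j := fun h hj => by
    simpa using hne (Nat.zero_le _) hj h.ne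
  by_cases hc : IsCollider G p k
  · rw [mutualInfo_eq_zero_of_isCollider hG hP hp hu hc (Nat.lt_succ_self k) hk, pos_iff_ne_zero,
      Ne, mutualInfo_eq_zero_iff]
    intro hind
    refine hfaithful {x} {p.getVert k} ∅ (by simpa using hx h0 hk.le) (by simp) (by simp)
      (condIndepNodes_empty hind) x (by simp) _ (by simp) (p.take k) (hp.take k)
      (isActive_take hcol (by simp))
  · have : ∀ v, Nonempty (E v) :=
      fun v => ⟨(nonempty_of_isProbabilityMeasure P).some v⟩
    refine klDiv_map_prod_lt_of_condIndepFun (measurable_pi_apply _) (measurable_pi_apply _)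
      (measurable_pi_apply _) (condIndepFun_of_not_isCollider hG hP hp hu h0 hk hc) ?_ hfin
    rw [← condIndepNodes_singleton]
    intro hind
    -- Independence given `xₖ₊₁` would contradict faithfulness: the segment up to `xₖ` has no
    -- collider and does not contain `xₖ₊₁`.
    refine hfaithful {x} {p.getVert k} {p.getVert (k + 1)} (by simpa using hx h0 hk.le)
      (by simpa using hx (Nat.succ_pos k) hk) (by simpa using hne hk.le hk (by omega)) hind
      x (by simp) _ (by simp) (p.take k) (hp.take k) (isActive_take hcol fun j hj => ?_)
    simpa using hne (hj.trans hk.le) hk (by omega)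

end MutualInfo

theorem mainTheorem6 {V : Type*} [Fintype V] [DecidableEq V] {E : V → Type*}
    [∀ v, MeasurableSpace (E v)] [∀ v, StandardBorelSpace (E v)]
    (G : Digraph V) (hG : G.IsDAG)
    (P : Measure (∀ v, E v)) [IsProbabilityMeasure P]
    (hP : Factorizes G P) (hfaithful : Faithful G P)
    {x y : V} (p : G.skeleton.Walk x y) (hp : p.IsPath)
    (htrail : IsTrailGraph G p ∨ IsUniqueTrail G p)
    (hfin : mutualInfo P x (p.getVert 1) ≠ ∞) :
    (∀ N ≤ p.length, (∀ m, m + 1 < N → ¬ IsCollider G p m) →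
      StrictAntiOn (fun k => mutualInfo P x (p.getVert k)) (Set.Icc 1 N)) ∧
    (∀ m, IsCollider G p m → ∀ j, m < j → j ≤ p.length →
      mutualInfo P x (p.getVert j) = 0) := by
  have hu : IsUniqueTrail G p := htrail.elim (fun h => h.isUniqueTrail hp) id
  refine ⟨fun N hN hcol => ?_, fun m hm j hmj hj =>
    mutualInfo_eq_zero_of_isCollider hG hP hp hu hm hmj hj⟩
  -- Only colliders before `xₖ` are excluded, so `N` may be one past the first collider, which
  -- includes the final drop to zero.
  have hstep : ∀ k, 0 < k → k < N → mutualInfo P x (p.getVert k) ≠ ∞ →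
      mutualInfo P x (p.getVert (k + 1)) < mutualInfo P x (p.getVert k) := fun k h0 hk h =>
    mutualInfo_succ_lt hG hP hfaithful hp hu h0 (hk.trans_le hN)
      (fun j hj => hcol j (by omega)) h
  have hne : ∀ k, 1 ≤ k → k ≤ N → mutualInfo P x (p.getVert k) ≠ ∞ := by
    intro k hk
    induction k, hk using Nat.le_induction with
    | base => exact fun _ => hfin
    | succ k hk ih => exact fun h => ((hstep k hk h (ih (by omega))).trans_le le_top).ne
  refine strictAntiOn_of_succ_lt Set.ordConnected_Icc fun k _ hk hk' => ?_
  exact hstep k hk.1 hk'.2 (hne k hk.1 hk.2)
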